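/- For a family $\mathcal F$ of sets let $\nu(\mathcal F)$, the matching number, be the maximum number of pairwise disjoint members of $\mathcal F$. Let $s>k\ge 5$ and $n$ be integers with $s>101k^3$ and $(s+1)k\le n<(s+1)\left(k+\frac{1}{100k}\right)$, write $[m]=\{1,\dots,m\}$, let $\binom{X}{k}$ denote the set of all $k$-element subsets of $X$, and put $\mathcal A=\binom{[(s+1)k-1]}{k}$. Then every family $\mathcal F\subset\binom{[n]}{k}$ with $\nu(\mathcal F)\le s$ satisfies $$|\mathcal F|\le|\mathcal A|=\binom{(s+1)k-1}{k}.$$ The bound is attained, since $\mathcal A\subset\binom{[n]}{k}$ and $\nu(\mathcal A)=s$. -/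

import Mathlib

/-- The matching number of a finite family of finite sets: the maximum number of
pairwise disjoint members of the family. -/
noncomputable def matchingNumber (F : Finset (Finset ℕ)) : ℕ :=
  open Classical in
  (F.powerset.filter fun M : Finset (Finset ℕ) => (M : Set (Finset ℕ)).PairwiseDisjoint id).sup Finset.card

/-- The clique family: all `k`-element subsets of `{1, …, (s + 1) k - 1}`. -/
def cliqueFamily (k s : ℕ) : Finset (Finset ℕ) :=
  (Finset.Icc 1 ((s + 1) * k - 1)).powersetCard k

/-!
Write `k = r + 1`, `m = (s + 1) k - 1` and `t = n - m`, so that `t` is at most about `s / (100 k)`.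
Shifting (replacing elements by smaller ones) neither changes the size of a family nor creates a
matching of `s + 1` members, so `F` may be assumed to be shifted. Let `G` be the number of `k`-subsets
of `[m]` missing from `F`, and `Z` the number of members of `F` not contained in `[m]`. As
`|F| = C(m, k) - G + Z`, the claim is `Z ≤ G`.

Let `a` be the number of `(k - 1)`-subsets `E` of `[m]` with `E ∪ {m + 1} ∈ F`. Shiftedness gives
`Z ≤ 2 t a`: at most `t a` members have exactly one element above `m`, and replacing an element above
`m` by one in `[m]` shows that the members with at least two such elements make up at most the
fraction `t / s` of `Z`. It remains to bound `a` by a multiple of `(k / s) G`.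

The main point is an averaging argument over random partitions of `V = [m + 1]` into `s + 1` blocks
of size `k`, each of them a stem of size `k - 1` together with a tip. A stem is *universal* if adding
any other point of `V` to it gives a member of `F`; by shiftedness each `E` counted by `a` is
universal. A block that is not in `F` can be repaired by means of `k` blocks with universal stems,
if the `k` tips of the latter form a member of `F`: distribute the points of the bad block over the
`k` stems, and let the `k` tips form a block of their own. If the number `h` of universal stems were
at least `k (N + g)`, where `g` counts the bad blocks and `N` the groups of tips outside `F`, all bad
blocks could be repaired at once and `F` would have a matching of size `s + 1`. Hence `h < k (N + g)`
always, and taking expectations (the tips being shuffled independently of the stems) the density of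
the universal sets is at most `k + 1` times the density of the missing `k`-sets of `V`
(`card_universal_mul_choose_le`). This amounts to `s a ≤ (k + 1) (G + C(m, k - 1))`.

The term `C(m, k - 1)` is harmless. If `a > 0`, fix one `E`; then `F` has no matching of size `s` on
the `s k` points of `[m] \ E`, and Kleitman's averaging argument (`choose_le_card_mul_card_missing`)
shows that `G ≥ C(s k - 1, k - 1) ≥ C(m, k - 1) / 2`. So `s a ≤ 3 (k + 1) G`, and `t ≤ s / (50 k)`
yields `Z ≤ 2 t a ≤ G`.
-/

/-! ### Matchings -/

/-- The family `F` has a matching indexed by `ι`: pairwise disjoint members `A i`, `i : ι`. As long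
as `∅ ∉ F`, the sets `A i` are automatically distinct. -/
def HasMatching (ι : Type*) {γ : Type*} (F : Finset (Finset γ)) : Prop :=
  ∃ A : ι → Finset γ, (∀ i, A i ∈ F) ∧ Pairwise (Function.onFun Disjoint A)

/-! ### Images of a fixed set under a random permutation -/

open Finset in
theorem exists_perm_map_eq {α : Type*} [Fintype α] [DecidableEq α] {Q Q' : Finset α}
    (h : #Q = #Q') : ∃ τ : Equiv.Perm α, Q.map τ.toEmbedding = Q' := by
  refine ⟨(Finset.equivOfCardEq h).extendSubtype, ?_⟩
  refine Finset.eq_of_subset_of_card_le ?_ (by simp [h])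
  intro x hx
  obtain ⟨y, hy, rfl⟩ := Finset.mem_map.1 hx
  exact Equiv.extendSubtype_mem (Finset.equivOfCardEq h) y hy

open Finset in
theorem card_perm_map_congr {α γ : Type*} [Fintype α] [DecidableEq α]
    (f : α ↪ γ) (p : Finset γ → Prop) [DecidablePred p] {Q Q' : Finset α} (h : #Q = #Q') :
    #{σ : Equiv.Perm α | p (Q.map (σ.toEmbedding.trans f))} =
      #{σ : Equiv.Perm α | p (Q'.map (σ.toEmbedding.trans f))} := by
  obtain ⟨τ, rfl⟩ := exists_perm_map_eq h
  refine (Finset.card_equiv (Equiv.mulRight τ) ?_).symm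
  intro σ
  simp only [mem_filter, mem_univ, true_and, Finset.map_map, Equiv.coe_mulRight]
  rfl

open Finset in
/-- For a random permutation `σ`, the image of `Q` under `f ∘ σ` is a uniformly distributed
`#Q`-subset of the range of `f`. -/
theorem card_perm_map_mul_choose {α γ : Type*} [Fintype α] [DecidableEq α]
    (f : α ↪ γ) (p : Finset γ → Prop) [DecidablePred p] (Q : Finset α) :
    #{σ : Equiv.Perm α | p (Q.map (σ.toEmbedding.trans f))} * (Fintype.card α).choose #Q =
      #{D ∈ (univ.map f).powersetCard #Q | p D} * (Fintype.card α).factorial := by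
  have key : ∑ Q' ∈ (univ : Finset α).powersetCard #Q,
      #{σ : Equiv.Perm α | p (Q'.map (σ.toEmbedding.trans f))} =
      ∑ σ : Equiv.Perm α,
        #{Q' ∈ (univ : Finset α).powersetCard #Q | p (Q'.map (σ.toEmbedding.trans f))} := by
    simp only [card_filter]
    exact sum_comm
  rw [sum_congr rfl (fun Q' hQ' => card_perm_map_congr f p (mem_powersetCard.1 hQ').2)] at key
  have h2 : ∀ σ : Equiv.Perm α,
      #{Q' ∈ (univ : Finset α).powersetCard #Q | p (Q'.map (σ.toEmbedding.trans f))} =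
      #{D ∈ (univ.map f).powersetCard #Q | p D} := by
    intro σ
    have : (univ : Finset α).map f = univ.map (σ.toEmbedding.trans f) := by
      rw [← Finset.map_map]; simp
    rw [this, powersetCard_map, filter_map, card_map]
    rfl
  rw [sum_congr rfl (fun σ _ => h2 σ), sum_const, sum_const, card_powersetCard, card_univ,
    card_univ, Fintype.card_perm] at key
  simp only [smul_eq_mul] at key
  linarith

/-! ### Repairing bad blocks -/

/-- The positions of the `i`-th block: all `r + 1` cells of row `i`. -/
abbrev blockPos {ι : Type*} (r : ℕ) (i : ι) : Finset (ι × Fin (r + 1)) := {i} ×ˢ Finset.univ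

/-- The positions of the stem of the `i`-th block: row `i` without its cell `0`. -/
abbrev stemPos {ι : Type*} (r : ℕ) (i : ι) : Finset (ι × Fin (r + 1)) := {i} ×ˢ {0}ᶜ

/-- The positions of the tips (cells `0`) of the rows in `J`. -/
abbrev tipPos {ι : Type*} (r : ℕ) (J : Finset ι) : Finset (ι × Fin (r + 1)) := J ×ˢ {0}

open Finset in
/-- Every block outside `bad` is in `F`, and the `l`-th point of a bad block `b` is absorbed by the
stem of the row `c b l`, whose tip is thereby released. If the tips released for `b` form a member of
`F`, for each `b`, then `F` has a matching. -/
theorem exists_disjoint_of_absorption {ι γ : Type*} [Fintype ι] [DecidableEq ι] [DecidableEq γ]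
    {r : ℕ} (e : ι × Fin (r + 1) ↪ γ) (F : Finset (Finset γ)) (bad : Finset ι)
    (hgood : ∀ i ∉ bad, (blockPos r i).map e ∈ F) (c : ι → Fin (r + 1) → ι)
    (hinj : ∀ b ∈ bad, ∀ b' ∈ bad, ∀ l l', c b l = c b' l' → b = b' ∧ l = l')
    (hbad : ∀ b ∈ bad, ∀ l, c b l ∉ bad)
    (habs : ∀ b ∈ bad, ∀ l, ∀ p ∉ stemPos r (c b l),
      insert (e p) ((stemPos r (c b l)).map e) ∈ F)
    (hc : ∀ b ∈ bad, (tipPos r (univ.image (c b))).map e ∈ F) :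
    HasMatching ι F := by
  classical
  -- `τ` exchanges the `l`-th point of the bad block `b` with the tip of block `c b l`.
  let τ : ι × Fin (r + 1) → ι × Fin (r + 1) := fun p =>
    if p.1 ∈ bad then (c p.1 p.2, 0)
    else if h : p.2 = 0 ∧ ∃ q : ι × Fin (r + 1), q.1 ∈ bad ∧ c q.1 q.2 = p.1 then h.2.choose
    else p
  have τbad : ∀ i l, i ∈ bad → τ (i, l) = (c i l, 0) := fun i l h => by simp [τ, h]
  have τc : ∀ b l, b ∈ bad → τ (c b l, 0) = (b, l) := by
    intro b l hb
    have h : (0 : Fin (r + 1)) = 0 ∧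
      ∃ q : ι × Fin (r + 1), q.1 ∈ bad ∧ c q.1 q.2 = c b l := ⟨rfl, (b, l), hb, rfl⟩
    have h1 : τ (c b l, 0) = h.2.choose := by
      unfold τ
      dsimp only
      rw [if_neg (hbad b hb l), dif_pos h]
    rw [h1]
    have h2 := h.2.choose_spec
    have h3 := hinj _ h2.1 _ hb _ _ h2.2
    exact Prod.ext h3.1 h3.2
  have τid : ∀ i l, i ∉ bad → (l ≠ 0 ∨ ∀ b l', b ∈ bad → c b l' ≠ i) → τ (i, l) = (i, l) := by
    intro i l hi h
    simp only [τ, hi, if_false]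
    rw [dif_neg]
    rintro ⟨h0, q, hq, hq'⟩
    rcases h with h | h
    · exact h h0
    · exact h _ _ hq hq'
  have τinv : Function.Involutive τ := by
    rintro ⟨i, l⟩
    by_cases hi : i ∈ bad
    · rw [τbad i l hi, τc i l hi]
    · by_cases h : l ≠ 0 ∨ ∀ b l', b ∈ bad → c b l' ≠ i
      · rw [τid i l hi h, τid i l hi h]
      · push Not at h
        obtain ⟨rfl, b, l', hb, rfl⟩ := h
        rw [τc b l' hb, τbad b l' hb]
  refine ⟨fun i => ((blockPos r i).image τ).map e, ?_, ?_⟩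
  · intro i
    dsimp only
    by_cases hi : i ∈ bad
    · convert hc i hi using 2
      ext ⟨a, b⟩
      simp only [mem_image, mem_product, mem_singleton, mem_univ, and_true, Prod.exists, true_and]
      constructor
      · rintro ⟨_, l, rfl, h⟩
        rw [τbad _ _ hi] at h
        cases h
        exact ⟨⟨_, rfl⟩, rfl⟩
      · rintro ⟨⟨l, rfl⟩, rfl⟩
        exact ⟨i, l, rfl, τbad _ _ hi⟩
    · by_cases h : ∃ b l, b ∈ bad ∧ c b l = i
      · obtain ⟨b, l, hb, rfl⟩ := h
        have hne : b ≠ c b l := fun h => hi (h ▸ hb)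
        have h4 := habs b hb l (b, l) (by simp [hne.symm])
        rw [← Finset.map_insert] at h4
        convert h4 using 2
        ext ⟨x, y⟩
        simp only [mem_image, mem_product, mem_singleton, mem_univ, and_true, Prod.exists,
          mem_insert, mem_compl]
        constructor
        · rintro ⟨_, l', rfl, h⟩
          by_cases hl : l' = 0
          · subst hl
            rw [τc b l hb] at h
            exact Or.inl h.symm
          · rw [τid _ _ hi (Or.inl hl)] at h
            cases h
            exact Or.inr ⟨rfl, hl⟩
        · rintro (h | ⟨rfl, hl⟩)
          · exact ⟨_, 0, rfl, by rw [τc b l hb, h]⟩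
          · exact ⟨_, y, rfl, τid _ _ hi (Or.inl hl)⟩
      · push Not at h
        convert hgood i hi using 2
        ext ⟨x, y⟩
        simp only [mem_image, mem_product, mem_singleton, mem_univ, and_true, Prod.exists]
        constructor
        · rintro ⟨_, l, rfl, h'⟩
          rw [τid _ _ hi (Or.inr h)] at h'
          cases h'; rfl
        · rintro rfl
          exact ⟨_, y, rfl, τid _ _ hi (Or.inr h)⟩
  · intro i j hij
    rw [Function.onFun, Finset.disjoint_map, Finset.disjoint_image τinv.injective,
      Finset.disjoint_left]
    simp only [mem_product, mem_singleton, mem_univ, and_true]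
    intro p h1 h2
    exact hij (h1.symm.trans h2)

/-! ### Averaging over blocks with shuffled tips -/

/-- The permutation of the cells that permutes the tips by `π` and fixes every stem cell. -/
def tipPerm {ι : Type*} (r : ℕ) (π : Equiv.Perm ι) : Equiv.Perm (ι × Fin (r + 1)) :=
  Equiv.prodCongrLeft fun l => if l = 0 then π else 1

theorem map_tipPerm_tipPos {ι : Type*} (r : ℕ) (π : Equiv.Perm ι) (J : Finset ι) :
    (tipPos r J).map (tipPerm r π).toEmbedding = tipPos r (J.map π.toEmbedding) := by
  ext ⟨x, y⟩
  simp only [Finset.mem_map, Finset.mem_product, Finset.mem_singleton, Prod.exists, tipPerm,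
    Equiv.coe_toEmbedding, Equiv.prodCongrLeft_apply, Prod.mk.injEq]
  constructor
  · rintro ⟨a, b, ⟨ha, rfl⟩, h1, rfl⟩
    exact ⟨⟨a, ha, by simpa using h1⟩, rfl⟩
  · rintro ⟨⟨a, ha, rfl⟩, rfl⟩
    exact ⟨a, 0, ⟨ha, rfl⟩, by simp, rfl⟩

theorem map_tipPerm_stemPos {ι : Type*} (r : ℕ) (π : Equiv.Perm ι) (i : ι) :
    (stemPos r i).map (tipPerm r π).toEmbedding = stemPos r i := by
  ext ⟨x, y⟩
  simp only [Finset.mem_map, Finset.mem_product, Finset.mem_singleton, Finset.mem_compl,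
    Prod.exists, tipPerm, Equiv.coe_toEmbedding, Equiv.prodCongrLeft_apply, Prod.mk.injEq]
  constructor
  · rintro ⟨a, b, ⟨rfl, hb⟩, h1, rfl⟩
    exact ⟨by simpa [hb] using h1.symm, hb⟩
  · rintro ⟨rfl, hb⟩
    exact ⟨x, y, ⟨rfl, hb⟩, by simp [hb], rfl⟩

theorem exists_disjoint_groups {ι : Type*} (k : ℕ) (S : Finset ι) :
    ∃ d : Fin (S.card / k) × Fin k → ι, Function.Injective d ∧ ∀ q, d q ∈ S := by
  have h : Fintype.card (Fin (S.card / k) × Fin k) ≤ Fintype.card S := by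
    simpa using Nat.div_mul_le_self _ _
  obtain ⟨φ⟩ := Function.Embedding.nonempty_of_card_le h
  exact ⟨fun q => φ q, fun a b h => φ.injective (Subtype.ext h), fun q => (φ q).2⟩

open Finset in
/-- For a family without a matching, the universal stems in `S`, divided by `d` into groups of size
`r + 1`, are too few to repair all bad blocks. -/
theorem card_universal_stems_lt {ι γ : Type*} [Fintype ι] [DecidableEq ι] [DecidableEq γ]
    {r : ℕ} (e : ι × Fin (r + 1) ↪ γ) (F : Finset (Finset γ))
    (hF : ¬ HasMatching ι F)
    (S : Finset ι)
    (hS : ∀ i ∈ S, ∀ x ∈ univ.map e, x ∉ (stemPos r i).map e →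
      insert x ((stemPos r i).map e) ∈ F)
    (d : Fin (#S / (r + 1)) × Fin (r + 1) → ι) (hd : Function.Injective d) (hdS : ∀ q, d q ∈ S) :
    #S < (r + 1) * (#{u | (tipPos r (univ.image fun l => d (u, l))).map e ∉ F} +
      #{i | (blockPos r i).map e ∉ F}) := by
  by_contra! hcon
  apply hF
  set bad : Finset ι := {i | (blockPos r i).map e ∉ F} with hbad
  set U : Finset (Fin (#S / (r + 1))) :=
    {u | (tipPos r (univ.image fun l => d (u, l))).map e ∈ F} with hU
  have hcard : #bad ≤ #U := by
    have h1 : #U + #{u | (tipPos r (univ.image fun l => d (u, l))).map e ∉ F} =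
        #S / (r + 1) := by
      rw [hU, card_filter_add_card_filter_not, card_univ, Fintype.card_fin]
    have h2 := (Nat.le_div_iff_mul_le (show 0 < r + 1 by omega)).2 (mul_comm (r + 1) _ ▸ hcon)
    omega
  obtain ⟨φ⟩ := Function.Embedding.nonempty_of_card_le
    (show Fintype.card bad ≤ Fintype.card U by simpa using hcard)
  -- A universal stem together with its own tip is a member of `F`.
  have hSbad : ∀ i ∈ S, i ∉ bad := by
    intro i hi hb
    have h0 : e (i, 0) ∉ (stemPos r i).map e := by simp
    have h1 := hS i hi (e (i, 0)) (by simp) h0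
    refine (mem_filter.1 hb).2 ?_
    convert h1
    rw [← Finset.map_insert]
    congr 1
    ext ⟨x, y⟩
    simp only [mem_product, mem_singleton, mem_univ, and_true, mem_insert, mem_compl,
      Prod.mk.injEq]
    tauto
  have hc : ∀ b (hb : b ∈ bad), (fun l => if h : b ∈ bad then d (φ ⟨b, h⟩, l) else b) =
      fun l => d (φ ⟨b, hb⟩, l) := by
    intro b hb; simp [hb]
  refine exists_disjoint_of_absorption e F bad (fun i hi => ?_)
    (fun b l => if h : b ∈ bad then d (φ ⟨b, h⟩, l) else b) ?_ ?_ ?_ ?_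
  · simpa [hbad] using hi
  · intro b hb b' hb' l l' h
    simp only [hb, hb', dif_pos] at h
    have h1 := hd h
    simp only [Prod.mk.injEq] at h1
    exact ⟨congrArg Subtype.val (φ.injective (Subtype.ext h1.1)), h1.2⟩
  · intro b hb l
    simp only [hb, dif_pos]
    exact hSbad _ (hdS _)
  · intro b hb l p hp
    simp only [hb, dif_pos] at hp ⊢
    refine hS _ (hdS _) _ (by simp) ?_
    rwa [mem_map']
  · intro b hb
    rw [hc b hb]
    exact (mem_filter.1 (φ ⟨b, hb⟩).2).2

open Finset in
/-- If the rows are grouped in a way that depends on the stems only, then the average number of groups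
whose tips do not form a member of `F` is at most `|ι| / (r + 1)` times the probability that a
random set is not in `F`: there are at most `|ι| / (r + 1)` groups, and a random permutation of the
tips makes the tips of any two groups equidistributed. -/
theorem mul_sum_card_bad_groups_le {ι γ : Type*} [Fintype ι] [DecidableEq ι] [DecidableEq γ]
    {r : ℕ} (f : ι × Fin (r + 1) ↪ γ) (F : Finset (Finset γ))
    (S : Equiv.Perm (ι × Fin (r + 1)) → Finset ι)
    (hS : ∀ σ π, S (σ * tipPerm r π) = S σ)
    (d : ∀ T : Finset ι, Fin (#T / (r + 1)) × Fin (r + 1) → ι)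
    (hd : ∀ T, Function.Injective (d T)) (i₀ : ι) (hι : r + 1 ≤ Fintype.card ι) :
    (r + 1) * ∑ σ : Equiv.Perm (ι × Fin (r + 1)),
      #{u | (tipPos r (univ.image fun l => d (S σ) (u, l))).map (σ.toEmbedding.trans f) ∉ F} ≤
    Fintype.card ι * #{σ : Equiv.Perm (ι × Fin (r + 1)) |
      (blockPos r i₀).map (σ.toEmbedding.trans f) ∉ F} := by
  -- The tips of a group have the same distribution as the tips of a fixed set `J₀` of rows.
  obtain ⟨J₀, -, hJ₀⟩ := exists_subset_card_eq (s := (univ : Finset ι)) (n := r + 1) (by simpa)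
  set g := #{σ : Equiv.Perm (ι × Fin (r + 1)) |
      (blockPos r i₀).map (σ.toEmbedding.trans f) ∉ F} with hg
  have hg' : ∀ J : Finset ι, #J = r + 1 → #{σ : Equiv.Perm (ι × Fin (r + 1)) |
      (tipPos r J).map (σ.toEmbedding.trans f) ∉ F} = g := by
    intro J hJ
    refine card_perm_map_congr f (fun D => D ∉ F) ?_
    simp [hJ]
  let N : Finset ι → Equiv.Perm (ι × Fin (r + 1)) → ℕ := fun T σ =>
    #{u | (tipPos r (univ.image fun l => d T (u, l))).map (σ.toEmbedding.trans f) ∉ F}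
  change (r + 1) * ∑ σ, N (S σ) σ ≤ _
  have hmap : ∀ (σ : Equiv.Perm (ι × Fin (r + 1))) (π : Equiv.Perm ι) (J : Finset ι),
      (tipPos r J).map ((σ * tipPerm r π).toEmbedding.trans f) =
        J.map (π.toEmbedding.trans
          ⟨fun i => f (σ (i, 0)), fun a b h => by simpa using h⟩) := by
    intro σ π J
    have : (σ * tipPerm r π).toEmbedding.trans f =
      (tipPerm r π).toEmbedding.trans (σ.toEmbedding.trans f) := rfl
    rw [this, ← Finset.map_map, map_tipPerm_tipPos]
    refine Eq.trans ?_ (Finset.map_map _ _ _)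
    ext x
    simp only [mem_map, mem_product, mem_singleton, Prod.exists]
    constructor
    · rintro ⟨a, b, ⟨ha, rfl⟩, rfl⟩
      exact ⟨a, ha, rfl⟩
    · rintro ⟨a, ha, rfl⟩
      exact ⟨a, 0, ⟨ha, rfl⟩, rfl⟩
  have hN : ∀ σ, ∑ π : Equiv.Perm ι, N (S σ) (σ * tipPerm r π) =
      (#(S σ) / (r + 1)) * #{π : Equiv.Perm ι |
        (tipPos r J₀).map ((σ * tipPerm r π).toEmbedding.trans f) ∉ F} := by
    intro σ
    simp only [N, card_filter]
    rw [sum_comm]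
    simp only [← card_filter, hmap]
    rw [sum_congr rfl (fun u _ => card_perm_map_congr _ (fun D => D ∉ F) (Q' := J₀) _)]
    · simp
    · intro u _
      rw [hJ₀, card_image_of_injective _ (fun a b h => by simpa using hd _ h)]
      simp
  have key : (Fintype.card ι).factorial * ∑ σ, N (S σ) σ =
      ∑ σ, (#(S σ) / (r + 1)) * #{π : Equiv.Perm ι |
        (tipPos r J₀).map ((σ * tipPerm r π).toEmbedding.trans f) ∉ F} := by
    calc (Fintype.card ι).factorial * ∑ σ, N (S σ) σ
        = ∑ π : Equiv.Perm ι, ∑ σ, N (S σ) σ := by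
          simp [Fintype.card_perm]
      _ = ∑ π : Equiv.Perm ι, ∑ σ, N (S σ) (σ * tipPerm r π) := by
          refine sum_congr rfl fun π _ => ?_
          rw [← Equiv.sum_comp (Equiv.mulRight (tipPerm r π))]
          simp [hS]
      _ = _ := by
          rw [sum_comm]
          exact sum_congr rfl fun σ _ => hN σ
  have key2 : ∑ σ : Equiv.Perm (ι × Fin (r + 1)), #{π : Equiv.Perm ι |
        (tipPos r J₀).map ((σ * tipPerm r π).toEmbedding.trans f) ∉ F} =
      (Fintype.card ι).factorial * g := by
    simp only [card_filter]
    rw [sum_comm]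
    calc _ = ∑ π : Equiv.Perm ι, g := by
          refine sum_congr rfl fun π _ => ?_
          rw [← hg' J₀ hJ₀, card_filter]
          exact Equiv.sum_comp (Equiv.mulRight (tipPerm r π))
            fun σ => if (tipPos r J₀).map (σ.toEmbedding.trans f) ∉ F then 1 else 0
      _ = _ := by simp [Fintype.card_perm]
  refine Nat.le_of_mul_le_mul_left ?_ (Nat.factorial_pos (Fintype.card ι))
  calc (Fintype.card ι).factorial * ((r + 1) * ∑ σ, N (S σ) σ)
      = ∑ σ, (r + 1) * (#(S σ) / (r + 1)) * #{π : Equiv.Perm ι |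
        (tipPos r J₀).map ((σ * tipPerm r π).toEmbedding.trans f) ∉ F} := by
        rw [mul_left_comm, key, mul_sum]
        simp only [mul_assoc]
    _ ≤ ∑ σ : Equiv.Perm (ι × Fin (r + 1)), Fintype.card ι * #{π : Equiv.Perm ι |
        (tipPos r J₀).map ((σ * tipPerm r π).toEmbedding.trans f) ∉ F} := by
        gcongr with σ
        exact (Nat.mul_div_le _ _).trans (card_le_univ _)
    _ = _ := by rw [← mul_sum, key2]; ring

open Finset in
/-- If `F` has no perfect matching on `V`, then the density of the `r`-subsets of `V` all of whose
one-point extensions lie in `F` is at most `r + 2` times the density of the `(r + 1)`-subsets of `V`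
missing from `F`. -/
theorem card_universal_mul_choose_le {ι γ : Type*} [Fintype ι] [DecidableEq ι] [DecidableEq γ]
    {r : ℕ} {V : Finset γ} (f : ι × Fin (r + 1) ↪ γ) (hV : univ.map f = V) (F : Finset (Finset γ))
    (hF : ¬ HasMatching ι F)
    (hι : r + 1 ≤ Fintype.card ι) :
    #{E ∈ V.powersetCard r | ∀ x ∈ V \ E, insert x E ∈ F} *
        (Fintype.card ι * (r + 1)).choose (r + 1) ≤
      (r + 2) * #{D ∈ V.powersetCard (r + 1) | D ∉ F} *
        (Fintype.card ι * (r + 1)).choose r := by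
  have hpos : 0 < Fintype.card ι := by omega
  obtain ⟨i₀⟩ := Fintype.card_pos_iff.1 hpos
  let H : Finset γ → Prop := fun E => ∀ x ∈ V \ E, insert x E ∈ F
  let : DecidablePred H := fun E => Finset.decidableDforallFinset
  choose d hd hdS using fun S : Finset ι => exists_disjoint_groups (r + 1) S
  let S : Equiv.Perm (ι × Fin (r + 1)) → Finset ι := fun σ =>
    {i | H ((stemPos r i).map (σ.toEmbedding.trans f))}
  -- Shuffling the tips does not affect which stems are universal.
  have hS : ∀ σ π, S (σ * tipPerm r π) = S σ := by
    intro σ π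
    have h1 : ∀ i, (stemPos r i).map ((σ * tipPerm r π).toEmbedding.trans f) =
        (stemPos r i).map (σ.toEmbedding.trans f) := by
      intro i
      conv_rhs => rw [← map_tipPerm_stemPos r π i, Finset.map_map]
      rfl
    simp only [S, h1]
  have huniv : ∀ σ : Equiv.Perm (ι × Fin (r + 1)),
      univ.map (σ.toEmbedding.trans f) = V := by
    intro σ; rw [← Finset.map_map]; simpa using hV
  set a := #{σ : Equiv.Perm (ι × Fin (r + 1)) |
    H ((stemPos r i₀).map (σ.toEmbedding.trans f))} with ha
  set g := #{σ : Equiv.Perm (ι × Fin (r + 1)) |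
    (blockPos r i₀).map (σ.toEmbedding.trans f) ∉ F} with hg
  have hsumS : ∑ σ, #(S σ) = Fintype.card ι * a := by
    simp only [S, card_filter]
    rw [sum_comm]
    simp only [← card_filter]
    rw [sum_congr rfl (fun i _ => card_perm_map_congr f H (Q' := stemPos r i₀) (by simp))]
    simp [ha]
  have hsumB : ∑ σ : Equiv.Perm (ι × Fin (r + 1)),
      #{i | (blockPos r i).map (σ.toEmbedding.trans f) ∉ F} = Fintype.card ι * g := by
    simp only [card_filter]
    rw [sum_comm]
    simp only [← card_filter]
    rw [sum_congr rfl (fun i _ => card_perm_map_congr f (fun D => D ∉ F)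
      (Q' := blockPos r i₀) (by simp))]
    simp [hg]
  have hN := mul_sum_card_bad_groups_le f F S hS d hd i₀ hι
  have hag : a ≤ (r + 2) * g := by
    have h1 : ∑ σ, #(S σ) ≤ ∑ σ : Equiv.Perm (ι × Fin (r + 1)), (r + 1) *
        (#{u | (tipPos r (univ.image fun l => d (S σ) (u, l))).map
          (σ.toEmbedding.trans f) ∉ F} +
        #{i | (blockPos r i).map (σ.toEmbedding.trans f) ∉ F}) := by
      refine sum_le_sum fun σ _ => (card_universal_stems_lt _ F hF (S σ) ?_ _ (hd _) (hdS _)).le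
      intro i hi x hx hx'
      rw [huniv σ] at hx
      exact (mem_filter.1 hi).2 x (mem_sdiff.2 ⟨hx, hx'⟩)
    rw [← mul_sum, sum_add_distrib, hsumS, hsumB] at h1
    refine Nat.le_of_mul_le_mul_left ?_ hpos
    rw [← hg] at hN
    nlinarith
  have e1 := card_perm_map_mul_choose f H (stemPos r i₀)
  have e2 := card_perm_map_mul_choose f (fun D => D ∉ F) (blockPos r i₀)
  rw [hV, ← ha] at e1
  rw [hV, ← hg] at e2
  simp only [card_product, card_singleton, card_compl, Fintype.card_fin, one_mul, card_univ,
    Fintype.card_prod, add_tsub_cancel_right] at e1 e2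
  have hfac : 0 < (Fintype.card ι * (r + 1)).factorial := Nat.factorial_pos _
  refine Nat.le_of_mul_le_mul_left ?_ hfac
  set M := Fintype.card ι * (r + 1)
  change M.factorial * (#{E ∈ V.powersetCard r | H E} * _) ≤ _
  calc M.factorial * (#{E ∈ V.powersetCard r | H E} * M.choose (r + 1))
      = a * M.choose r * M.choose (r + 1) := by rw [e1]; ring
    _ ≤ (r + 2) * g * M.choose r * M.choose (r + 1) := by gcongr
    _ = (r + 2) * (g * M.choose (r + 1)) * M.choose r := by ring
    _ = _ := by rw [e2]; ring

open Finset in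
/-- Kleitman's bound: if `F` has no perfect matching on `V`, then each partition of `V` into blocks
has a block outside `F`, so that the density of the missing sets is at least `1 / |ι|`. -/
theorem choose_le_card_mul_card_missing {ι γ : Type*} [Fintype ι] [DecidableEq ι] [Nonempty ι]
    [DecidableEq γ] {r : ℕ} {V : Finset γ}
    (f : ι × Fin (r + 1) ↪ γ) (hV : univ.map f = V) (F : Finset (Finset γ))
    (hF : ¬ HasMatching ι F) :
    (Fintype.card ι * (r + 1)).choose (r + 1) ≤
      Fintype.card ι * #{D ∈ V.powersetCard (r + 1) | D ∉ F} := by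
  obtain ⟨i₀⟩ := ‹Nonempty ι›
  set g := #{σ : Equiv.Perm (ι × Fin (r + 1)) |
    (blockPos r i₀).map (σ.toEmbedding.trans f) ∉ F} with hg
  have e2 := card_perm_map_mul_choose f (fun D => D ∉ F) (blockPos r i₀)
  rw [hV, ← hg] at e2
  simp only [card_product, card_singleton, Fintype.card_fin, one_mul, card_univ,
    Fintype.card_prod] at e2
  have hsumB : ∑ σ : Equiv.Perm (ι × Fin (r + 1)),
      #{i | (blockPos r i).map (σ.toEmbedding.trans f) ∉ F} = Fintype.card ι * g := by
    simp only [card_filter]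
    rw [sum_comm]
    simp only [← card_filter]
    rw [sum_congr rfl (fun i _ => card_perm_map_congr f (fun D => D ∉ F)
      (Q' := blockPos r i₀) (by simp))]
    simp [hg]
  have h1 : ∑ σ : Equiv.Perm (ι × Fin (r + 1)), 1 ≤ ∑ σ : Equiv.Perm (ι × Fin (r + 1)),
      #{i | (blockPos r i).map (σ.toEmbedding.trans f) ∉ F} := by
    refine sum_le_sum fun σ _ => ?_
    rw [Nat.one_le_iff_ne_zero, Finset.card_ne_zero]
    by_contra hcon
    rw [not_nonempty_iff_eq_empty, filter_eq_empty_iff] at hcon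
    refine hF ⟨fun i => (blockPos r i).map (σ.toEmbedding.trans f),
      fun i => not_not.1 (hcon (mem_univ i)), fun i j hij => ?_⟩
    rw [Function.onFun, Finset.disjoint_map, Finset.disjoint_left]
    simp only [mem_product, mem_singleton, mem_univ, and_true]
    intro p h1 h2
    exact hij (h1.symm.trans h2)
  rw [hsumB] at h1
  simp only [sum_const, card_univ, Fintype.card_perm, Fintype.card_prod, Fintype.card_fin,
    smul_eq_mul, mul_one] at h1
  have hfac : 0 < (Fintype.card ι * (r + 1)).factorial := Nat.factorial_pos _
  refine Nat.le_of_mul_le_mul_left ?_ hfac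
  set M := Fintype.card ι * (r + 1)
  calc M.factorial * M.choose (r + 1) ≤ Fintype.card ι * g * M.choose (r + 1) := by gcongr
    _ = Fintype.card ι * (g * M.choose (r + 1)) := by ring
    _ = _ := by rw [e2]; ring

/-! ### Shifting -/

/-- The family `F` of sets of positive integers is shifted: replacing an element of a member by a
smaller positive integer outside it gives a member again. -/
def IsShifted (F : Finset (Finset ℕ)) : Prop :=
  ∀ A ∈ F, ∀ j ∈ A, ∀ i, 1 ≤ i → i < j → i ∉ A → insert i (A.erase j) ∈ F

/-- The effect of the `(i, j)`-shift of `F` on a single member `A`: the element `j` is replaced by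
`i` if this is possible and leads out of `F`. -/
def shiftSet (i j : ℕ) (F : Finset (Finset ℕ)) (A : Finset ℕ) : Finset ℕ :=
  if j ∈ A ∧ i ∉ A ∧ A.map (Equiv.swap i j).toEmbedding ∉ F then
    A.map (Equiv.swap i j).toEmbedding else A

/-- The `(i, j)`-shift of the family `F`. -/
def shiftFamily (i j : ℕ) (F : Finset (Finset ℕ)) : Finset (Finset ℕ) :=
  F.image (shiftSet i j F)

theorem map_swap_eq_insert_erase {i j : ℕ} {A : Finset ℕ} (hj : j ∈ A) (hi : i ∉ A) :
    A.map (Equiv.swap i j).toEmbedding = insert i (A.erase j) := by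
  ext x
  simp only [Finset.mem_map_equiv, Equiv.symm_swap, Finset.mem_insert, Finset.mem_erase]
  by_cases h1 : x = i
  · subst h1; simp [hj]
  · by_cases h2 : x = j
    · subst h2; simp [hi, h1]
    · rw [Equiv.swap_apply_of_ne_of_ne h1 h2]; simp [h1, h2]

theorem map_swap_eq_self {i j : ℕ} {A : Finset ℕ} (h : i ∈ A ↔ j ∈ A) :
    A.map (Equiv.swap i j).toEmbedding = A := by
  ext x
  simp only [Finset.mem_map_equiv, Equiv.symm_swap]
  by_cases h1 : x = i
  · subst h1; simp [h]
  · by_cases h2 : x = j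
    · subst h2; simp [h]
    · rw [Equiv.swap_apply_of_ne_of_ne h1 h2]

theorem map_swap_map_swap (i j : ℕ) (A : Finset ℕ) :
    (A.map (Equiv.swap i j).toEmbedding).map (Equiv.swap i j).toEmbedding = A := by
  ext x; simp

/-- A shifted member is not in `F`, so it differs from all members that stay as they are. -/
theorem shiftSet_injOn (i j : ℕ) (F : Finset (Finset ℕ)) :
    Set.InjOn (shiftSet i j F) F := by
  intro A hA B hB h
  unfold shiftSet at h
  split_ifs at h with h1 h2 h2
  · exact Finset.map_injective _ h
  · exact absurd (h ▸ hB) h1.2.2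
  · exact absurd (h.symm ▸ hA) h2.2.2
  · exact h

theorem card_shiftFamily (i j : ℕ) (F : Finset (Finset ℕ)) :
    (shiftFamily i j F).card = F.card :=
  Finset.card_image_of_injOn (shiftSet_injOn i j F)

theorem mem_shiftFamily {i j : ℕ} {F : Finset (Finset ℕ)} {C : Finset ℕ}
    (hC : C ∈ shiftFamily i j F) :
    (C ∈ F ∧ (j ∈ C → i ∉ C → C.map (Equiv.swap i j).toEmbedding ∈ F)) ∨
      (C ∉ F ∧ C.map (Equiv.swap i j).toEmbedding ∈ F ∧ i ∈ C ∧ j ∉ C) := by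
  obtain ⟨A, hA, rfl⟩ := Finset.mem_image.1 hC
  unfold shiftSet
  split_ifs with h
  · right
    refine ⟨h.2.2, by rwa [map_swap_map_swap], ?_, ?_⟩
    · simp [Finset.mem_map_equiv, h.1]
    · simp [Finset.mem_map_equiv, h.2.1]
  · left
    refine ⟨hA, fun hj hi => ?_⟩
    by_contra hcon
    exact h ⟨hj, hi, hcon⟩

theorem shiftFamily_subset {k n i j : ℕ} {F : Finset (Finset ℕ)}
    (hF : F ⊆ (Finset.Icc 1 n).powersetCard k) (hi : 1 ≤ i) (hij : i < j) :
    shiftFamily i j F ⊆ (Finset.Icc 1 n).powersetCard k := by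
  intro C hC
  obtain ⟨A, hA, rfl⟩ := Finset.mem_image.1 hC
  have h0 := Finset.mem_powersetCard.1 (hF hA)
  unfold shiftSet
  split_ifs with h
  · refine Finset.mem_powersetCard.2 ⟨?_, by simp [h0.2]⟩
    rw [map_swap_eq_insert_erase h.1 h.2.1]
    have hj := Finset.mem_Icc.1 (h0.1 h.1)
    refine Finset.insert_subset (Finset.mem_Icc.2 ⟨hi, by omega⟩)
      ((Finset.erase_subset _ _).trans h0.1)
  · exact hF hA

/-- At most one member of a matching of the shifted family contains `i`. If that member is new, then
applying the transposition of `i` and `j` to all members gives a matching of `F`. -/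
theorem HasMatching.of_shiftFamily {ι : Type*} {i j : ℕ} {F : Finset (Finset ℕ)}
    (h : HasMatching ι (shiftFamily i j F)) : HasMatching ι F := by
  obtain ⟨A, hA, hdisj⟩ := h
  by_cases hall : ∀ l, A l ∈ F
  · exact ⟨A, hall, hdisj⟩
  · push Not at hall
    obtain ⟨l₀, hl₀⟩ := hall
    have h0 := (mem_shiftFamily (hA l₀)).resolve_left (fun h => hl₀ h.1)
    refine ⟨fun l => (A l).map (Equiv.swap i j).toEmbedding, fun l => ?_, fun l l' hl => ?_⟩
    · by_cases hll : l = l₀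
      · exact hll ▸ h0.2.1
      · have hi : i ∉ A l := fun hi => Finset.disjoint_left.1 (hdisj hll) hi h0.2.2.1
        have h1 := (mem_shiftFamily (hA l)).resolve_right (fun h => hi h.2.2.1)
        by_cases hj : j ∈ A l
        · exact h1.2 hj hi
        · dsimp only
          rw [map_swap_eq_self (by simp [hi, hj])]
          exact h1.1
    · exact (Finset.disjoint_map _).2 (hdisj hl)

theorem sum_shiftSet_le {i j : ℕ} (hij : i < j) (F : Finset (Finset ℕ)) (A : Finset ℕ) :
    ∑ a ∈ shiftSet i j F A, a ≤ ∑ a ∈ A, a ∧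
      (j ∈ A → i ∉ A → A.map (Equiv.swap i j).toEmbedding ∉ F →
        ∑ a ∈ shiftSet i j F A, a < ∑ a ∈ A, a) := by
  unfold shiftSet
  split_ifs with h
  · have h1 : ∑ a ∈ A.map (Equiv.swap i j).toEmbedding, a < ∑ a ∈ A, a := by
      rw [map_swap_eq_insert_erase h.1 h.2.1, Finset.sum_insert (by simp [h.2.1]),
        ← Finset.add_sum_erase A (fun a => a) h.1]
      simpa using hij
    exact ⟨h1.le, fun _ _ _ => h1⟩
  · exact ⟨le_rfl, fun h1 h2 h3 => absurd ⟨h1, h2, h3⟩ h⟩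

/-- Repeated shifting lowers the sum of all elements of all members, hence ends in a shifted family. -/
theorem exists_isShifted {ι : Type*} {k n : ℕ} {F : Finset (Finset ℕ)}
    (hF : F ⊆ (Finset.Icc 1 n).powersetCard k) (hmat : ¬ HasMatching ι F) :
    ∃ F' ⊆ (Finset.Icc 1 n).powersetCard k, F'.card = F.card ∧ ¬ HasMatching ι F' ∧
      IsShifted F' := by
  induction hw : ∑ A ∈ F, ∑ a ∈ A, a using Nat.strong_induction_on generalizing F with
  | _ w ih =>
    by_cases hs : IsShifted F
    · exact ⟨F, hF, rfl, hmat, hs⟩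
    · unfold IsShifted at hs
      push Not at hs
      obtain ⟨A, hA, j, hj, i, hi, hij, hiA, hnot⟩ := hs
      have hlt : ∑ A ∈ shiftFamily i j F, ∑ a ∈ A, a < w := by
        rw [shiftFamily, Finset.sum_image (shiftSet_injOn i j F), ← hw]
        refine Finset.sum_lt_sum (fun B _ => (sum_shiftSet_le hij F B).1) ⟨A, hA, ?_⟩
        exact (sum_shiftSet_le hij F A).2 hj hiA (by rwa [map_swap_eq_insert_erase hj hiA])
      obtain ⟨F', h1, h2, h3⟩ := ih _ hlt (shiftFamily_subset hF hi hij)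
        (fun h => hmat h.of_shiftFamily) rfl
      exact ⟨F', h1, h2.trans (card_shiftFamily i j F), h3⟩

/-! ### Shifted families without large matchings -/

open Finset in
theorem exists_embedding_map_univ_eq {α γ : Type*} [Fintype α] {V : Finset γ}
    (h : Fintype.card α = #V) : ∃ f : α ↪ γ, univ.map f = V := by
  classical
  have e : α ≃ V := Fintype.equivOfCardEq (by simpa using h)
  refine ⟨e.toEmbedding.trans (Function.Embedding.subtype _), ?_⟩
  rw [← Finset.map_map, map_univ_equiv, univ_eq_attach]
  exact attach_map_val

theorem choose_add_le (N c q : ℕ) :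
    (N + c).choose (q + 1) ≤ N.choose (q + 1) + c * (N + c - 1).choose q := by
  induction c with
  | zero => simp
  | succ c ih =>
    have h1 : (N + (c + 1)).choose (q + 1) = (N + c).choose q + (N + c).choose (q + 1) :=
      Nat.choose_succ_succ _ _
    have h2 : (N + c - 1).choose q ≤ (N + c).choose q := Nat.choose_le_choose _ (by omega)
    have h3 : N + (c + 1) - 1 = N + c := by omega
    rw [h1, h3]
    nlinarith

/-- Deleting `c` points of a ground set of size `N + c ≥ 2 c r` destroys at most half of its
`r`-subsets, as each point lies in the fraction `r / (N + c)` of them. -/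
theorem choose_le_two_mul_choose {N c r : ℕ} (h : 2 * (c * r) ≤ N + c) :
    (N + c).choose r ≤ 2 * N.choose r := by
  obtain _ | q := r
  · simp
  obtain _ | c := c
  · simp; omega
  · have h1 := choose_add_le N (c + 1) q
    have h2 := Nat.add_one_mul_choose_eq (N + c) q
    have h3 : N + (c + 1) - 1 = N + c := by omega
    have h4 : N + c + 1 = N + (c + 1) := by omega
    rw [h3] at h1
    rw [h4] at h2
    set C := (N + (c + 1)).choose (q + 1)
    set D := (N + c).choose q
    have h5 : 2 * ((c + 1) * D) ≤ C := by
      refine Nat.le_of_mul_le_mul_left ?_ (show 0 < N + (c + 1) by omega)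
      calc (N + (c + 1)) * (2 * ((c + 1) * D)) = 2 * (c + 1) * ((N + (c + 1)) * D) := by ring
        _ = C * (2 * ((c + 1) * (q + 1))) := by rw [h2]; ring
        _ ≤ C * (N + (c + 1)) := by gcongr
        _ = _ := mul_comm _ _
    omega

section
variable {r s n m : ℕ} {F : Finset (Finset ℕ)}
open Finset

/-- The link of `m + 1` consists of universal sets of `[m + 1]`, and at most `m.choose r` of the sets
missing from `F` contain `m + 1`. -/
theorem IsShifted.mul_card_link_le (hm : m + 1 = (s + 1) * (r + 1)) (hrs : r ≤ s)
    (hsh : IsShifted F) (hmat : ¬ HasMatching (Fin (s + 1)) F) :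
    s * #{E ∈ (Icc 1 m).powersetCard r | insert (m + 1) E ∈ F} ≤
      (r + 2) * (#{D ∈ (Icc 1 m).powersetCard (r + 1) | D ∉ F} + m.choose r) := by
  obtain ⟨f, hf⟩ := exists_embedding_map_univ_eq (α := Fin (s + 1) × Fin (r + 1))
    (V := Icc 1 (m + 1)) (by simp [hm])
  have key := card_universal_mul_choose_le f hf F hmat (by simpa using hrs)
  rw [Fintype.card_fin, ← hm] at key
  set a := #{E ∈ (Icc 1 m).powersetCard r | insert (m + 1) E ∈ F} with ha
  set G := #{D ∈ (Icc 1 m).powersetCard (r + 1) | D ∉ F} with hG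
  have hins : Icc 1 (m + 1) = insert (m + 1) (Icc 1 m) := by
    ext x; simp only [mem_Icc, mem_insert]; omega
  have ha' : a ≤ #{E ∈ (Icc 1 (m + 1)).powersetCard r |
      ∀ x ∈ Icc 1 (m + 1) \ E, insert x E ∈ F} := by
    refine card_le_card fun E hE => ?_
    rw [mem_filter, mem_powersetCard] at hE
    rw [mem_filter, mem_powersetCard]
    refine ⟨⟨hE.1.1.trans (Icc_subset_Icc_right (by omega)), hE.1.2⟩, fun x hx => ?_⟩
    rw [mem_sdiff, mem_Icc] at hx
    have hmE : m + 1 ∉ E := fun h => by have := mem_Icc.1 (hE.1.1 h); omega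
    by_cases hxm : x = m + 1
    · rw [hxm]; exact hE.2
    · have h1 := hsh _ hE.2 (m + 1) (mem_insert_self _ _) x hx.1.1 (by omega)
        (by simp [hxm, hx.2])
      rwa [erase_insert hmE] at h1
  have hG' : #{D ∈ (Icc 1 (m + 1)).powersetCard (r + 1) | D ∉ F} ≤ G + m.choose r := by
    rw [hins, powersetCard_succ_insert (by simp), filter_union]
    refine (card_union_le _ _).trans (Nat.add_le_add_left ?_ _)
    refine (card_filter_le _ _).trans (card_image_le.trans ?_)
    simp
  set a' := #{E ∈ (Icc 1 (m + 1)).powersetCard r |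
      ∀ x ∈ Icc 1 (m + 1) \ E, insert x E ∈ F}
  set G' := #{D ∈ (Icc 1 (m + 1)).powersetCard (r + 1) | D ∉ F}
  have hch := Nat.choose_succ_right_eq (m + 1) r
  have hsub : m + 1 - r = s * (r + 1) + 1 := by
    have : (s + 1) * (r + 1) = s * (r + 1) + 1 + r := by ring
    omega
  have hpos : 0 < (m + 1).choose r := Nat.choose_pos (by omega)
  rw [hsub] at hch
  have h1 : a' * (s * (r + 1) + 1) ≤ (r + 1) * ((r + 2) * G') := by
    refine Nat.le_of_mul_le_mul_left ?_ hpos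
    calc (m + 1).choose r * (a' * (s * (r + 1) + 1))
        = a' * ((m + 1).choose r * (s * (r + 1) + 1)) := by ring
      _ = a' * (m + 1).choose (r + 1) * (r + 1) := by rw [← hch]; ring
      _ ≤ (r + 2) * G' * (m + 1).choose r * (r + 1) := by gcongr
      _ = _ := by ring
  refine Nat.le_of_mul_le_mul_left ?_ (show 0 < r + 1 by omega)
  calc (r + 1) * (s * a) = a * (s * (r + 1)) := by ring
    _ ≤ a' * (s * (r + 1) + 1) := by gcongr; omega
    _ ≤ (r + 1) * ((r + 2) * G') := h1
    _ ≤ _ := by gcongr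

/-- If `insert (m + 1) E ∈ F`, then `F` has no perfect matching on the rest of `[m]`, so that many
`(r + 1)`-subsets of `[m]` are missing. -/
theorem choose_le_two_mul_card_missing (hm : m + 1 = (s + 1) * (r + 1)) (hrs : 2 * r ≤ s)
    (hs : 0 < s) (hmat : ¬ HasMatching (Fin (s + 1)) F) {E : Finset ℕ}
    (hE : E ∈ (Icc 1 m).powersetCard r) (hEF : insert (m + 1) E ∈ F) :
    m.choose r ≤ 2 * #{D ∈ (Icc 1 m).powersetCard (r + 1) | D ∉ F} := by
  obtain ⟨q, rfl⟩ : ∃ q, s = q + 1 := ⟨s - 1, by omega⟩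
  rw [mem_powersetCard] at hE
  set W := Icc 1 m \ E with hW
  have hWc : #W = (q + 1) * (r + 1) := by
    have : (q + 1 + 1) * (r + 1) = (q + 1) * (r + 1) + r + 1 := by ring
    rw [hW, card_sdiff_of_subset hE.1, hE.2, Nat.card_Icc]
    omega
  obtain ⟨f, hf⟩ := exists_embedding_map_univ_eq (α := Fin (q + 1) × Fin (r + 1))
    (V := W) (by simp [hWc])
  have hmat' : ¬ HasMatching (Fin (q + 1)) (F.filter (· ⊆ W)) := by
    rintro ⟨A, hA, hdisj⟩
    have hdE : ∀ i, Disjoint (insert (m + 1) E) (A i) := by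
      intro i
      rw [disjoint_right]
      intro x hx hx'
      have h1 := (mem_filter.1 (hA i)).2 hx
      rw [hW, mem_sdiff, mem_Icc] at h1
      rcases mem_insert.1 hx' with h2 | h2
      · omega
      · exact h1.2 h2
    refine hmat ⟨Fin.cons (insert (m + 1) E) A, fun i => ?_, fun i j hij => ?_⟩
    · refine Fin.cases ?_ (fun i => ?_) i
      · exact hEF
      · exact (mem_filter.1 (hA i)).1
    · rw [Function.onFun]
      induction i using Fin.cases with
      | zero =>
        induction j using Fin.cases with
        | zero => exact absurd rfl hij
        | succ j => simpa using hdE j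
      | succ i =>
        induction j using Fin.cases with
        | zero => simpa using (hdE i).symm
        | succ j => simpa using hdisj (fun h => hij (congrArg Fin.succ h))
  have key := choose_le_card_mul_card_missing f hf _ hmat'
  rw [Fintype.card_fin] at key
  have hle : #{D ∈ W.powersetCard (r + 1) | D ∉ F.filter (· ⊆ W)} ≤
      #{D ∈ (Icc 1 m).powersetCard (r + 1) | D ∉ F} := by
    refine card_le_card fun D hD => ?_
    rw [mem_filter, mem_powersetCard, mem_filter] at hD
    rw [mem_filter, mem_powersetCard]
    exact ⟨⟨hD.1.1.trans sdiff_subset, hD.1.2⟩, fun h => hD.2 ⟨h, hD.1.1⟩⟩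
  set G := #{D ∈ (Icc 1 m).powersetCard (r + 1) | D ∉ F}
  obtain ⟨N, hN⟩ : ∃ N, (q + 1) * (r + 1) = N + 1 :=
    ⟨(q + 1) * (r + 1) - 1, (Nat.sub_add_cancel (Nat.succ_le_of_lt (by positivity))).symm⟩
  have hmN : m = N + (r + 1) := by
    have : (q + 1 + 1) * (r + 1) = (q + 1) * (r + 1) + r + 1 := by ring
    omega
  have h1 : N.choose r ≤ G := by
    have h2 := Nat.add_one_mul_choose_eq N r
    refine Nat.le_of_mul_le_mul_left ?_ (show 0 < (q + 1) * (r + 1) by positivity)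
    rw [hN] at key
    calc (q + 1) * (r + 1) * N.choose r = (N + 1).choose (r + 1) * (r + 1) := by rw [hN, h2]
      _ ≤ ((q + 1) * G) * (r + 1) := by gcongr; exact key.trans (by gcongr)
      _ = _ := by ring
  have h3 : m.choose r ≤ 2 * N.choose r := by
    rw [hmN]
    refine choose_le_two_mul_choose ?_
    rw [← hmN]
    nlinarith
  omega

theorem IsShifted.card_one_above_le (hF : F ⊆ (Icc 1 n).powersetCard (r + 1))
    (hsh : IsShifted F) :
    #{A ∈ F | #{y ∈ A | m < y} = 1} ≤
      #{E ∈ (Icc 1 m).powersetCard r | insert (m + 1) E ∈ F} * (n - m) := by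
  have hsub : {A ∈ F | #{y ∈ A | m < y} = 1} ⊆
      ({E ∈ (Icc 1 m).powersetCard r | insert (m + 1) E ∈ F} ×ˢ Ioc m n).image
        (fun p => insert p.2 p.1) := by
    intro A hA
    rw [mem_filter, card_eq_one] at hA
    obtain ⟨hA, y, hy⟩ := hA
    have hyA : y ∈ A ∧ m < y := by
      have : y ∈ A.filter (m < ·) := by rw [hy]; exact mem_singleton_self _
      simpa using this
    have hA' := mem_powersetCard.1 (hF hA)
    have hother : ∀ x ∈ A, x ≠ y → x ≤ m := by
      intro x hx hxy
      by_contra hcon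
      have : x ∈ A.filter (m < ·) := mem_filter.2 ⟨hx, by omega⟩
      rw [hy, mem_singleton] at this
      exact hxy this
    rw [mem_image]
    refine ⟨(A.erase y, y), ?_, insert_erase hyA.1⟩
    rw [mem_product, mem_filter, mem_powersetCard, mem_Ioc]
    refine ⟨⟨⟨fun x hx => ?_, ?_⟩, ?_⟩, hyA.2, (mem_Icc.1 (hA'.1 hyA.1)).2⟩
    · rw [mem_erase] at hx
      exact mem_Icc.2 ⟨(mem_Icc.1 (hA'.1 hx.2)).1, hother x hx.2 hx.1⟩
    · rw [card_erase_of_mem hyA.1, hA'.2]; rfl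
    · by_cases hym : y = m + 1
      · rw [← hym, insert_erase hyA.1]; exact hA
      · refine hsh A hA y hyA.1 (m + 1) (by omega) (by omega) fun h => ?_
        have := hother _ h (Ne.symm hym)
        omega
  refine (card_le_card hsub).trans (card_image_le.trans ?_)
  rw [card_product, Nat.card_Ioc]

/-- Double counting of the pairs formed by a member with at least two elements above `m` and the
member that arises from it by replacing one of these by an element of `[m]`. -/
theorem IsShifted.card_two_above_mul_le (hm : m + 1 = (s + 1) * (r + 1))
    (hF : F ⊆ (Icc 1 n).powersetCard (r + 1)) (hsh : IsShifted F) :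
    #{A ∈ F | 2 ≤ #{y ∈ A | m < y}} * s ≤ #{A ∈ F | 1 ≤ #{y ∈ A | m < y}} * (n - m) := by
  have key : #{A ∈ F | 2 ≤ #{y ∈ A | m < y}} * (s * (r + 1)) ≤
      #{A ∈ F | 1 ≤ #{y ∈ A | m < y}} * ((r + 1) * (n - m)) := by
    classical
    obtain ⟨R, hR⟩ : ∃ R : Finset ℕ → Finset ℕ → Prop, ∀ A A', R A A' ↔ ∃ y ∈ A, m < y ∧
      ∃ x ∈ Icc 1 m, x ∉ A ∧ A' = insert x (A.erase y) := ⟨_, fun _ _ => Iff.rfl⟩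
    refine card_mul_le_card_mul R ?_ ?_
    · intro A hA
      rw [mem_filter] at hA
      have hA' := mem_powersetCard.1 (hF hA.1)
      obtain ⟨y, hy⟩ := card_pos.1 (show 0 < #{y ∈ A | m < y} by omega)
      rw [mem_filter] at hy
      calc s * (r + 1) ≤ #(Icc 1 m \ A) := by
            have h1 : #(Icc 1 m ∩ A) ≤ r := by
              have h2 : Icc 1 m ∩ A ⊆ A.erase y := by
                intro x hx
                rw [mem_inter, mem_Icc] at hx
                exact mem_erase.2 ⟨by omega, hx.2⟩
              have h3 := card_le_card h2
              rw [card_erase_of_mem hy.1, hA'.2] at h3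
              exact h3
            have h4 := card_sdiff_add_card_inter (Icc 1 m) A
            rw [Nat.card_Icc] at h4
            have : (s + 1) * (r + 1) = s * (r + 1) + r + 1 := by ring
            omega
        _ = #((Icc 1 m \ A).image fun x => insert x (A.erase y)) := by
            rw [card_image_of_injOn]
            intro x hx x' hx' h
            have hx1 : x ∉ A := (mem_sdiff.1 hx).2
            have : x ∈ insert x' (A.erase y) := by
              rw [← show insert x (A.erase y) = insert x' (A.erase y) from h]
              exact mem_insert_self _ _
            rcases mem_insert.1 this with h | h
            · exact h
            · exact absurd (mem_of_mem_erase h) hx1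
        _ ≤ _ := by
            refine card_le_card fun A' hA'' => ?_
            obtain ⟨x, hx, rfl⟩ := mem_image.1 hA''
            rw [mem_sdiff] at hx
            have hx1 := mem_Icc.1 hx.1
            rw [bipartiteAbove, mem_filter, mem_filter, hR]
            refine ⟨⟨hsh A hA.1 y hy.1 x hx1.1 (hx1.2.trans_lt hy.2) hx.2, ?_⟩,
              y, hy.1, hy.2, x, hx.1, hx.2, rfl⟩
            have hsub : (A.filter (m < ·)).erase y ⊆
                (insert x (A.erase y)).filter (m < ·) := by
              intro z hz
              simp only [mem_erase, mem_filter, mem_insert] at hz ⊢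
              tauto
            have h5 := card_le_card hsub
            rw [card_erase_of_mem (mem_filter.2 hy)] at h5
            exact (Nat.le_sub_one_of_lt hA.2).trans h5
    · intro A' hA'
      rw [mem_filter] at hA'
      have hA'' := mem_powersetCard.1 (hF hA'.1)
      have hsub : bipartiteBelow R {A ∈ F | 2 ≤ #{y ∈ A | m < y}} A' ⊆
          (A' ×ˢ Ioc m n).image (fun p => insert p.2 (A'.erase p.1)) := by
        intro A hA
        rw [bipartiteBelow, mem_filter, mem_filter, hR] at hA
        obtain ⟨⟨hAF, -⟩, y, hy, hmy, x, hx, hxA, rfl⟩ := hA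
        rw [mem_image]
        refine ⟨(x, y), ?_, ?_⟩
        · rw [mem_product, mem_Ioc]
          exact ⟨mem_insert_self _ _, hmy,
            (mem_Icc.1 ((mem_powersetCard.1 (hF hAF)).1 hy)).2⟩
        · dsimp only
          rw [erase_insert (fun h => hxA (mem_of_mem_erase h)), insert_erase hy]
      refine (card_le_card hsub).trans (card_image_le.trans ?_)
      rw [card_product, Nat.card_Ioc, hA''.2]
  refine Nat.le_of_mul_le_mul_left ?_ (show 0 < r + 1 by omega)
  linarith

/-- A shifted family on `[n]` without a matching of size `s + 1` has at most as many members as the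
clique on `[m]`, if `n` exceeds `m = (s + 1) (r + 1) - 1` by at most `s / (50 (r + 1))`. -/
theorem IsShifted.card_le_choose (hm : m + 1 = (s + 1) * (r + 1)) (hr : 1 ≤ r)
    (hF : F ⊆ (Icc 1 n).powersetCard (r + 1)) (hsh : IsShifted F)
    (hmat : ¬ HasMatching (Fin (s + 1)) F) (hs : 0 < s) (hrs : 2 * r ≤ s)
    (hn : 50 * (r + 1) * (n - m) ≤ s) :
    #F ≤ m.choose (r + 1) := by
  have hone := hsh.card_one_above_le (m := m) hF
  have htwo := hsh.card_two_above_mul_le hm hF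
  have hlink := hsh.mul_card_link_le hm (by omega) hmat
  have hmiss : 0 < #{E ∈ (Icc 1 m).powersetCard r | insert (m + 1) E ∈ F} →
      m.choose r ≤ 2 * #{D ∈ (Icc 1 m).powersetCard (r + 1) | D ∉ F} := by
    intro h
    obtain ⟨E, hE⟩ := card_pos.1 h
    rw [mem_filter] at hE
    exact choose_le_two_mul_card_missing hm hrs hs hmat hE.1 hE.2
  have hsplit : #{A ∈ F | 1 ≤ #{y ∈ A | m < y}} =
      #{A ∈ F | #{y ∈ A | m < y} = 1} + #{A ∈ F | 2 ≤ #{y ∈ A | m < y}} := by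
    rw [← card_union_of_disjoint, ← filter_or]
    · congr 1
      ext A
      simp only [mem_filter]
      refine and_congr_right fun _ => ?_
      omega
    · rw [disjoint_filter]
      intro A _ h1 h2
      omega
  have htotal : #F = #{A ∈ F | 1 ≤ #{y ∈ A | m < y}} +
      #{D ∈ (Icc 1 m).powersetCard (r + 1) | D ∈ F} := by
    rw [← card_filter_add_card_filter_not (s := F) (fun A => 1 ≤ #{y ∈ A | m < y})]
    congr 2
    ext A
    simp only [mem_filter, mem_powersetCard, Nat.one_le_iff_ne_zero, not_not, card_eq_zero,
      filter_eq_empty_iff, not_lt]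
    constructor
    · rintro ⟨hA, h⟩
      have hA' := mem_powersetCard.1 (hF hA)
      exact ⟨⟨fun x hx => mem_Icc.2 ⟨(mem_Icc.1 (hA'.1 hx)).1, h hx⟩, hA'.2⟩, hA⟩
    · rintro ⟨⟨h1, -⟩, hA⟩
      exact ⟨hA, fun x hx => (mem_Icc.1 (h1 hx)).2⟩
  have hcompl := card_filter_add_card_filter_not (s := (Icc 1 m).powersetCard (r + 1))
    (fun D => D ∈ F)
  rw [card_powersetCard, Nat.card_Icc, Nat.add_sub_cancel] at hcompl
  set a := #{E ∈ (Icc 1 m).powersetCard r | insert (m + 1) E ∈ F}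
  set G := #{D ∈ (Icc 1 m).powersetCard (r + 1) | D ∉ F}
  set Z := #{A ∈ F | 1 ≤ #{y ∈ A | m < y}}
  set Z₁ := #{A ∈ F | #{y ∈ A | m < y} = 1}
  set Z₂ := #{A ∈ F | 2 ≤ #{y ∈ A | m < y}}
  set t := n - m
  have h2t : 2 * t ≤ s := by nlinarith
  have hZ₂ : 2 * Z₂ ≤ Z := by
    refine Nat.le_of_mul_le_mul_right ?_ hs
    nlinarith
  have hZ : Z ≤ 2 * (a * t) := by omega
  have hZG : Z ≤ G := by
    rcases Nat.eq_zero_or_pos a with h0 | h0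
    · rw [h0] at hZ; omega
    · have h1 := hmiss h0
      have h2 : s * a ≤ (r + 2) * (3 * G) := hlink.trans (by gcongr; omega)
      have h3 : 50 * (r + 1) * t * a ≤ s * a := by gcongr
      refine Nat.le_of_mul_le_mul_left ?_ (show 0 < 25 * (r + 1) by omega)
      nlinarith
  omega
end

theorem not_hasMatching_of_matchingNumber_le {k n s : ℕ} (hk : 0 < k) {F : Finset (Finset ℕ)}
    (hF : F ⊆ (Finset.Icc 1 n).powersetCard k) (h : matchingNumber F ≤ s) :
    ¬ HasMatching (Fin (s + 1)) F := by
  classical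
  rintro ⟨A, hA, hdisj⟩
  have hinj : Function.Injective A := by
    intro i j hij
    by_contra hne
    have h1 := hdisj hne
    rw [Function.onFun, hij, disjoint_self, Finset.bot_eq_empty] at h1
    have h2 := (Finset.mem_powersetCard.1 (hF (hA j))).2
    rw [h1, Finset.card_empty] at h2
    omega
  have h1 : (Finset.univ.image A).card ≤ matchingNumber F := by
    refine Finset.le_sup (f := Finset.card) ?_
    rw [Finset.mem_filter, Finset.mem_powerset]
    refine ⟨fun B hB => ?_, ?_⟩
    · obtain ⟨i, -, rfl⟩ := Finset.mem_image.1 hB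
      exact hA i
    · intro B hB C hC hne
      obtain ⟨i, -, rfl⟩ := Finset.mem_image.1 hB
      obtain ⟨j, -, rfl⟩ := Finset.mem_image.1 hC
      exact hdisj (fun h => hne (congrArg A h))
  rw [Finset.card_image_of_injective _ hinj, Finset.card_univ, Fintype.card_fin] at h1
  omega

theorem matchingNumber_cliqueFamily {k : ℕ} (hk : 0 < k) (s : ℕ) :
    matchingNumber (cliqueFamily k s) = s := by
  classical
  have hpos : 0 < (s + 1) * k := by positivity
  apply le_antisymm
  · refine Finset.sup_le fun M hM => ?_
    rw [Finset.mem_filter, Finset.mem_powerset] at hM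
    have h1 : (M.biUnion id).card = M.card * k := by
      rw [Finset.card_biUnion hM.2]
      exact Finset.sum_const_nat fun B hB => (Finset.mem_powersetCard.1 (hM.1 hB)).2
    have h2 : M.biUnion id ⊆ Finset.Icc 1 ((s + 1) * k - 1) :=
      Finset.biUnion_subset.2 fun B hB => (Finset.mem_powersetCard.1 (hM.1 hB)).1
    have h3 := Finset.card_le_card h2
    rw [h1, Nat.card_Icc] at h3
    have h4 : M.card * k < (s + 1) * k := by omega
    exact Nat.lt_succ_iff.1 (Nat.lt_of_mul_lt_mul_right h4)
  · -- The consecutive intervals `(i k, (i + 1) k]`, `i < s`, are pairwise disjoint.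
    let A : ℕ → Finset ℕ := fun i => Finset.Ioc (i * k) ((i + 1) * k)
    have hdisj : ∀ i j, i ≠ j → Disjoint (A i) (A j) := by
      have hlt : ∀ i j, i < j → Disjoint (A i) (A j) := by
        intro i j hij
        rw [Finset.disjoint_left]
        intro x hx hx'
        have h1 := (Finset.mem_Ioc.1 hx).2
        have h2 := (Finset.mem_Ioc.1 hx').1
        have h3 : (i + 1) * k ≤ j * k := Nat.mul_le_mul_right k hij
        omega
      intro i j hij
      rcases Nat.lt_or_gt_of_ne hij with h | h
      · exact hlt i j h
      · exact (hlt j i h).symm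
    have hcard : ∀ i, (A i).card = k := by
      intro i
      rw [Nat.card_Ioc, add_mul, one_mul, Nat.add_sub_cancel_left]
    have hinj : Function.Injective A := by
      intro i j hij
      by_contra hne
      have h1 := hdisj i j hne
      rw [hij, disjoint_self, Finset.bot_eq_empty] at h1
      have h2 := hcard j
      rw [h1, Finset.card_empty] at h2
      omega
    have h1 : ((Finset.range s).image A).card ≤ matchingNumber (cliqueFamily k s) := by
      refine Finset.le_sup (f := Finset.card) ?_
      rw [Finset.mem_filter, Finset.mem_powerset]
      refine ⟨fun B hB => ?_, ?_⟩
      · obtain ⟨i, hi, rfl⟩ := Finset.mem_image.1 hB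
        refine Finset.mem_powersetCard.2 ⟨fun x hx => ?_, hcard i⟩
        have h1 := Finset.mem_Ioc.1 hx
        have h2 : (i + 1) * k ≤ s * k := Nat.mul_le_mul_right k (Finset.mem_range.1 hi)
        have h3 : (s + 1) * k = s * k + k := by ring
        exact Finset.mem_Icc.2 ⟨by omega, by omega⟩
      · intro B hB C hC hne
        obtain ⟨i, -, rfl⟩ := Finset.mem_image.1 hB
        obtain ⟨j, -, rfl⟩ := Finset.mem_image.1 hC
        exact hdisj i j (fun h => hne (congrArg A h))
    rwa [Finset.card_image_of_injective _ hinj, Finset.card_range] at h1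

theorem card_cliqueFamily (k s : ℕ) : (cliqueFamily k s).card = ((s + 1) * k - 1).choose k := by
  rw [cliqueFamily, Finset.card_powersetCard, Nat.card_Icc, Nat.add_sub_cancel]

theorem theorem2 (n k s : ℕ) (hk : 5 ≤ k) (hks : k < s) (hs : 101 * k ^ 3 < s)
    (hn₁ : (s + 1) * k ≤ n)
    (hn₂ : (n : ℝ) < ((s : ℝ) + 1) * ((k : ℝ) + 1 / (100 * (k : ℝ)))) :
    (∀ F : Finset (Finset ℕ), F ⊆ (Finset.Icc 1 n).powersetCard k → matchingNumber F ≤ s →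
      F.card ≤ (cliqueFamily k s).card) ∧
    (cliqueFamily k s).card = ((s + 1) * k - 1).choose k ∧
    cliqueFamily k s ⊆ (Finset.Icc 1 n).powersetCard k ∧
    matchingNumber (cliqueFamily k s) = s := by
  refine ⟨fun F hF hν => ?_, card_cliqueFamily k s, ?_, matchingNumber_cliqueFamily (by omega) s⟩
  · rw [card_cliqueFamily]
    obtain ⟨F', hF', hcard, hmat, hsh⟩ :=
      exists_isShifted hF (not_hasMatching_of_matchingNumber_le (by omega) hF hν)
    rw [← hcard]
    -- The upper bound on `n`, cleared of its denominator.
    have hnat : 100 * k * n < (s + 1) * (100 * k * k + 1) := by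
      have hk0 : (0 : ℝ) < k := by exact_mod_cast (by omega : 0 < k)
      have h1 : 100 * (k : ℝ) * n < 100 * k * (((s : ℝ) + 1) * (k + 1 / (100 * k))) := by
        gcongr
      have h2 : 100 * (k : ℝ) * (((s : ℝ) + 1) * (k + 1 / (100 * k))) =
          ((s : ℝ) + 1) * (100 * k * k + 1) := by
        field_simp
      rw [h2] at h1
      exact_mod_cast h1
    have hk3 : k * 25 ≤ k ^ 3 := by
      rw [pow_succ', pow_two]
      exact Nat.mul_le_mul_left k (by nlinarith)
    obtain ⟨r, rfl⟩ : ∃ r, k = r + 1 := ⟨k - 1, by omega⟩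
    obtain ⟨m, hm⟩ : ∃ m, m + 1 = (s + 1) * (r + 1) :=
      ⟨(s + 1) * (r + 1) - 1, Nat.sub_add_cancel (Nat.succ_le_of_lt (by positivity))⟩
    have hm' : (s + 1) * (r + 1) - 1 = m := by omega
    rw [hm']
    -- Since `n - m < (s + 1) / (100 k) + 1` and `s > 101 k ^ 3`, the excess `n - m` is at most
    -- `s / (50 k)`.
    refine hsh.card_le_choose hm (by omega) hF' hmat (by omega) (by omega) ?_
    obtain ⟨t, rfl⟩ : ∃ t, n = m + t := ⟨n - m, by omega⟩
    rw [Nat.add_sub_cancel_left]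
    have h3 : 100 * (r + 1) * (m + t) + 100 * (r + 1) < (s + 1) + 100 * (r + 1) * ((m + 1) + 1) := by
      rw [hm]
      nlinarith
    nlinarith
  · exact Finset.powersetCard_mono (Finset.Icc_subset_Icc_right (by omega))
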